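/- **Setting.** A generalized flow network consists of a finite set $V$ of nodes, a finite set $E$ of arcs (parallel arcs allowed), and a finite set $J$ of items. Each arc $e$ goes from a tail to a head and has a gain factor $\gamma_e>0$, a capacity $u_e\in[0,\infty]$ and a cost $c_e\in\mathbb R$ per unit of flow entering it; if $f_e$ units enter $e$ at its tail, then $\gamma_e f_e$ units arrive at its head. Each node $w$ has bounds $\ell_w,h_w\in[-\infty,\infty]$ (for instance $\ell_w=h_w=0$ for flow conservation, $\ell_w=h_w=b_w$ for a prescribed excess, $\ell_w=-a$ and $h_w=0$ for a sink that absorbs at most $a$ units), and each item $j$ is supplied at a node $\sigma(j)\in V$. For $x\in\mathbb R_{\ge 0}^J$, a feasible flow for $x$ is a pair $(f,s)\in\mathbb R^E\times\mathbb R^J$ such that $0\le f_e\le u_e$ for all $e\in E$, $0\le s_j\le x_j$ for all $j\in J$, and $$\ell_w\ \le\ \sum_{e\text{ with tail }w} f_e-\sum_{e\text{ with head }w}\gamma_e f_e-\sum_{j:\sigma(j)=w}s_j\ \le\ h_w\qquad\text{for all } w\in V .$$ The generalized flow valuation is $$v(x)=\sup\Big\{-\sum_{e\in E}c_ef_e:\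 (f,s)\text{ is a feasible flow for }x\Big\}\in[-\infty,\infty],$$ that is, minus the minimum cost of a generalized flow using at most $x_j$ units of each item $j$ (with $v(x)=-\infty$ if no feasible flow exists). For a price vector $q\in\mathbb R^J$, let $D(v,q)$ be the set of all $x\in\mathbb R_{\ge0}^J$ such that $v(x)$ is finite and $v(y)-q\cdot y\le v(x)-q\cdot x$ for all $y\in\mathbb R_{\ge0}^J$. The valuation $v$ is *linear-substitute* if for all $q,q'\in\mathbb R^J$ with $q\le q'$ and every $x\in D(v,q)$ there is $x'\in D(v,q')$ with $x'_j\ge x_j$ for every $j\in J$ with $q_j=q'_j$. **Theorem.** For every generalized flow network, the generalized flow valuation $v$ is linear-substitute. -/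

import Mathlib

open scoped ENNReal

/-- A generalized flow network (a flow network with gain factors) with node set `V`, arc set `E`
(parallel arcs and loops allowed) and item set `J`; item `j` is supplied at the node `entry j`.
If `f e` units enter the arc `e` at its tail `src e`, then `gain e * f e` units leave it at its
head `tgt e`; the arc has capacity `cap e` (possibly infinite) and cost `cost e` per unit entering
it. At each node `w`, the net outflow minus the supplied amount has to lie between `lower w` and
`upper w` (extended reals): `lower w = upper w = b` prescribes the excess `b`,
`lower w = ⊥` allows any surplus to be absorbed at `w`, and so on. -/
structure GenFlowNetwork (V E J : Type*) where
  src : E → V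
  tgt : E → V
  gain : E → ℝ
  gain_pos : ∀ e, 0 < gain e
  cap : E → ℝ≥0∞
  cost : E → ℝ
  lower : V → EReal
  upper : V → EReal
  entry : J → V

namespace GenFlowNetwork

variable {V E J : Type*} [Fintype E] [Fintype J] [DecidableEq V]

/-- Net outflow at `w`: flow entering arcs at their tail `w`, minus flow that arrives at `w`
through arcs with head `w`, after multiplication by the gain factors. -/
def netOutflow (N : GenFlowNetwork V E J) (f : E → ℝ) (w : V) : ℝ :=
  (∑ e, if N.src e = w then f e else 0) - ∑ e, if N.tgt e = w then N.gain e * f e else 0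

/-- Total amount supplied at the node `w` when item `j` is used in the amount `s j`. -/
def supplyAt (N : GenFlowNetwork V E J) (s : J → ℝ) (w : V) : ℝ :=
  ∑ j, if N.entry j = w then s j else 0

/-- `(f, s)` is a feasible flow when at most `x j` units of each item `j` are available;
`s j` is the amount of item `j` that is actually used. -/
structure IsFeasible (N : GenFlowNetwork V E J) (x : J → ℝ) (f : E → ℝ) (s : J → ℝ) : Prop where
  flow_nonneg : ∀ e, 0 ≤ f e
  flow_le_cap : ∀ e, ENNReal.ofReal (f e) ≤ N.cap e
  supply_nonneg : ∀ j, 0 ≤ s j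
  supply_le : ∀ j, s j ≤ x j
  lower_le : ∀ w, N.lower w ≤ ((N.netOutflow f w - N.supplyAt s w : ℝ) : EReal)
  le_upper : ∀ w, ((N.netOutflow f w - N.supplyAt s w : ℝ) : EReal) ≤ N.upper w

/-- Total cost of a flow. -/
def flowCost (N : GenFlowNetwork V E J) (f : E → ℝ) : ℝ := ∑ e, N.cost e * f e

/-- The generalized flow valuation: the negative of the minimum cost of a generalized flow that
uses at most `x j` units of each item `j`. It is `⊥` if there is no feasible flow and `⊤` if the
cost is unbounded below. -/
noncomputable def valuation (N : GenFlowNetwork V E J) (x : J → ℝ) : EReal :=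
  sSup {a : EReal | ∃ f s, N.IsFeasible x f s ∧ a = ((-N.flowCost f : ℝ) : EReal)}

end GenFlowNetwork

/-- The demand set `D(v, q)` of a valuation `v` on `ℝ₊ᴶ` at the price vector `q`: the bundles of
finite value that maximize the quasi-linear utility `v x - q ⬝ x` among all `x ≥ 0`. -/
def demandSet {J : Type*} [Fintype J] (v : (J → ℝ) → EReal) (q : J → ℝ) : Set (J → ℝ) :=
  {x | 0 ≤ x ∧ v x ≠ ⊥ ∧ v x ≠ ⊤ ∧
    ∀ y : J → ℝ, 0 ≤ y →
      v y - ((∑ j, q j * y j : ℝ) : EReal) ≤ v x - ((∑ j, q j * x j : ℝ) : EReal)}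

/-- A valuation is linear-substitute if, when prices (weakly) increase from `q` to `q'`, every
bundle demanded at `q` admits a bundle demanded at `q'` that contains at least as much of each
item whose price did not change. -/
def IsLinearSubstitute {J : Type*} [Fintype J] (v : (J → ℝ) → EReal) : Prop :=
  ∀ q q' : J → ℝ, q ≤ q' → ∀ x ∈ demandSet v q,
    ∃ x' ∈ demandSet v q', ∀ j, q j = q' j → x j ≤ x' j

section LinearProgram

variable {M ι : Type*} [AddCommGroup M] [Module ℝ M] [Finite ι]

/-- From a feasible point one can move along a descent direction that is orthogonal to all tight
constraints until a further constraint becomes tight. -/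
theorem exists_tight_ssubset (a : ι → M →ₗ[ℝ] ℝ) (b : ι → ℝ) (c : M →ₗ[ℝ] ℝ) (m : ℝ)
    (hm : ∀ y, (∀ i, a i y ≤ b i) → m ≤ c y) (y d : M) (hy : ∀ i, a i y ≤ b i)
    (hd : ∀ i, a i y = b i → a i d = 0) (hc : c d < 0) :
    ∃ y', (∀ i, a i y' ≤ b i) ∧ c y' ≤ c y ∧ {i | a i y' ≠ b i} ⊂ {i | a i y ≠ b i} := by
  have := Fintype.ofFinite ι
  classical
  let S : Finset ι := Finset.univ.filter fun i => 0 < a i d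
  have hS : S.Nonempty := by
    by_contra hS
    have hle : ∀ i, a i d ≤ 0 := fun i => by
      by_contra hi
      exact hS ⟨i, by simpa [S] using hi⟩
    have ht : 0 ≤ (c y - m + 1) / (-c d) :=
      div_nonneg (by linarith [hm y hy]) (by linarith)
    have h := hm (y + ((c y - m + 1) / (-c d)) • d) fun i => by
      have := mul_nonpos_of_nonneg_of_nonpos ht (hle i)
      simp only [map_add, map_smul, smul_eq_mul]
      linarith [hy i]
    have h2 : (c y - m + 1) / (-c d) * c d = -(c y - m + 1) := by
      rw [div_neg, neg_mul, div_mul_cancel₀ _ hc.ne]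
    simp only [map_add, map_smul, smul_eq_mul] at h
    linarith
  obtain ⟨k, hk, hmin⟩ := S.exists_min_image (fun i => (b i - a i y) / a i d) hS
  have hkd : 0 < a k d := by simpa [S] using hk
  have hkt : a k y ≠ b k := fun h => hkd.ne' (hd k h)
  set t := (b k - a k y) / a k d with ht
  have ht0 : 0 ≤ t := div_nonneg (by linarith [hy k]) hkd.le
  refine ⟨y + t • d, fun i => ?_, ?_, ?_⟩
  · simp only [map_add, map_smul, smul_eq_mul]
    rcases le_or_gt (a i d) 0 with h | h
    · linarith [hy i, mul_nonpos_of_nonneg_of_nonpos ht0 h]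
    · have := hmin i (by simpa [S] using h)
      rw [le_div_iff₀ h] at this
      linarith
  · simp only [map_add, map_smul, smul_eq_mul]
    linarith [mul_nonpos_of_nonneg_of_nonpos ht0 hc.le]
  · refine (Set.ssubset_iff_of_subset fun i hi => mt (fun h => ?_) hi).2 ⟨k, hkt, fun h => h ?_⟩
    · simp [hd i h, h]
    · simp only [map_add, map_smul, smul_eq_mul, ht]
      field_simp
      ring_nf

/-- Every feasible point of a bounded linear program is dominated by one at which the objective is
constant along the directions orthogonal to all tight constraints. -/
theorem exists_le_forall_tight (a : ι → M →ₗ[ℝ] ℝ) (b : ι → ℝ) (c : M →ₗ[ℝ] ℝ) (m : ℝ)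
    (hm : ∀ y, (∀ i, a i y ≤ b i) → m ≤ c y) (y : M) (hy : ∀ i, a i y ≤ b i) :
    ∃ y', (∀ i, a i y' ≤ b i) ∧ c y' ≤ c y ∧ ∀ d, (∀ i, a i y' = b i → a i d = 0) → c d = 0 := by
  induction hn : {i | a i y ≠ b i}.ncard using Nat.strong_induction_on generalizing y with
  | _ n ih =>
    by_cases h : ∀ d, (∀ i, a i y = b i → a i d = 0) → c d = 0
    · exact ⟨y, hy, le_rfl, h⟩
    · push Not at h
      obtain ⟨d, hd, hcd⟩ := h
      obtain ⟨d, hd, hcd⟩ : ∃ d, (∀ i, a i y = b i → a i d = 0) ∧ c d < 0 := by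
        rcases hcd.lt_or_gt with h | h
        · exact ⟨d, hd, h⟩
        · exact ⟨-d, fun i hi => by simp [hd i hi], by simpa using h⟩
      obtain ⟨y₁, h₁, hc₁, hss⟩ := exists_tight_ssubset a b c m hm y d hy hd hcd
      obtain ⟨y₂, h₂, hc₂, h₃⟩ := ih _ (hn ▸ Set.ncard_lt_ncard hss) y₁ h₁ rfl
      exact ⟨y₂, h₂, hc₂.trans hc₁, h₃⟩

/-- A feasible linear program whose objective is bounded below attains its minimum. -/
theorem exists_isMin_linearProgram (a : ι → M →ₗ[ℝ] ℝ) (b : ι → ℝ) (c : M →ₗ[ℝ] ℝ) (m : ℝ)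
    (hm : ∀ y, (∀ i, a i y ≤ b i) → m ≤ c y) (hne : ∃ y, ∀ i, a i y ≤ b i) :
    ∃ y, (∀ i, a i y ≤ b i) ∧ ∀ y', (∀ i, a i y' ≤ b i) → c y ≤ c y' := by
  let S : Set M :=
    {y | (∀ i, a i y ≤ b i) ∧ ∀ d, (∀ i, a i y = b i → a i d = 0) → c d = 0}
  have hfin : (c '' S).Finite := by
    let T : M → Set ι := fun y => {i | a i y = b i}
    have : Set.InjOn (fun r => T '' (S ∩ c ⁻¹' {r})) (c '' S) := by
      rintro _ ⟨y₁, hy₁, rfl⟩ _ ⟨y₂, hy₂, rfl⟩ h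
      have h1 : T y₁ ∈ T '' (S ∩ c ⁻¹' {c y₁}) := ⟨y₁, ⟨hy₁, rfl⟩, rfl⟩
      simp only at h
      rw [h] at h1
      obtain ⟨y₃, ⟨hy₃, hc₃⟩, hT⟩ := h1
      have hc₃ : c y₃ = c y₂ := hc₃
      have := hy₁.2 (y₁ - y₃) fun i hi => by
        have h3 : i ∈ T y₃ := hT ▸ hi
        have h3 : a i y₃ = b i := h3
        rw [map_sub, hi, h3, sub_self]
      rw [map_sub] at this
      linarith
    exact Set.Finite.of_finite_image (Set.toFinite _) this
  obtain ⟨y₀, hy₀⟩ := hne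
  obtain ⟨y₁, h₁, -, h₁'⟩ := exists_le_forall_tight a b c m hm y₀ hy₀
  obtain ⟨y, hy, hmin⟩ := Set.exists_min_image (c '' S) id hfin ⟨_, y₁, ⟨h₁, h₁'⟩, rfl⟩
  obtain ⟨y, hyS, rfl⟩ := hy
  refine ⟨y, hyS.1, fun y' hy' => ?_⟩
  obtain ⟨y₂, h₂, hle, h₂'⟩ := exists_le_forall_tight a b c m hm y' hy'
  exact (hmin _ ⟨y₂, ⟨h₂, h₂'⟩, rfl⟩).trans hle

/-- A version of `exists_isMin_linearProgram` with extended real right-hand sides. -/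
theorem exists_isMin_linearProgram_ereal (a : ι → M →ₗ[ℝ] ℝ) (b : ι → EReal) (c : M →ₗ[ℝ] ℝ)
    (m : ℝ) (hm : ∀ y, (∀ i, (a i y : EReal) ≤ b i) → m ≤ c y)
    (hne : ∃ y, ∀ i, (a i y : EReal) ≤ b i) :
    ∃ y, (∀ i, (a i y : EReal) ≤ b i) ∧ ∀ y', (∀ i, (a i y' : EReal) ≤ b i) → c y ≤ c y' := by
  classical
  have hbot : ∀ i, b i ≠ ⊥ := fun i h => by
    obtain ⟨y, hy⟩ := hne
    have := hy i
    rw [h, le_bot_iff] at this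
    exact EReal.coe_ne_bot _ this
  have key : ∀ y, (∀ i, (a i y : EReal) ≤ b i) ↔
      ∀ i, (if b i = ⊤ then 0 else a i) y ≤ (b i).toReal := fun y =>
    forall_congr' fun i => by
      split_ifs with h
      · simp [h]
      · rw [← EReal.coe_le_coe_iff, EReal.coe_toReal h (hbot i)]
  simp only [key] at hm hne ⊢
  exact exists_isMin_linearProgram _ _ c m hm hne

end LinearProgram

namespace GenFlowNetwork

variable {V E J : Type*} [Fintype E] [Fintype J] [DecidableEq V]

/-- Net outflow at a node as a linear functional of the flow. -/
def netOutflowₗ (N : GenFlowNetwork V E J) (w : V) : (E → ℝ) →ₗ[ℝ] ℝ where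
  toFun f := N.netOutflow f w
  map_add' f g := by
    simp only [netOutflow, ← Finset.sum_sub_distrib, ← Finset.sum_add_distrib]
    refine Finset.sum_congr rfl fun e _ => ?_
    simp only [Pi.add_apply]
    split_ifs <;> ring
  map_smul' r f := by
    simp only [netOutflow, ← Finset.sum_sub_distrib, smul_eq_mul, Finset.mul_sum, RingHom.id_apply]
    refine Finset.sum_congr rfl fun e _ => ?_
    simp only [Pi.smul_apply, smul_eq_mul]
    split_ifs <;> ring

/-- The supply at a node as a linear functional of the amounts supplied. -/
def supplyAtₗ (N : GenFlowNetwork V E J) (w : V) : (J → ℝ) →ₗ[ℝ] ℝ where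
  toFun s := N.supplyAt s w
  map_add' f g := by
    simp only [supplyAt, ← Finset.sum_add_distrib]
    refine Finset.sum_congr rfl fun e _ => ?_
    split_ifs <;> simp only [Pi.add_apply, add_zero]
  map_smul' r f := by
    simp only [supplyAt, smul_eq_mul, Finset.mul_sum, RingHom.id_apply]
    refine Finset.sum_congr rfl fun e _ => ?_
    split_ifs <;> simp only [Pi.smul_apply, smul_eq_mul, mul_zero]

/-- The excess at a node as a linear functional of the flow and the amounts supplied. -/
def excessₗ (N : GenFlowNetwork V E J) (w : V) : (E → ℝ) × (J → ℝ) →ₗ[ℝ] ℝ :=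
  N.netOutflowₗ w ∘ₗ LinearMap.fst ℝ _ _ - N.supplyAtₗ w ∘ₗ LinearMap.snd ℝ _ _

theorem excessₗ_apply (N : GenFlowNetwork V E J) (w : V) (f : E → ℝ) (s : J → ℝ) :
    N.excessₗ w (f, s) = N.netOutflow f w - N.supplyAt s w := rfl

/-- The total expense of a flow when the items used are bought at prices `q`, as a linear
functional. -/
def expenseₗ (N : GenFlowNetwork V E J) (q : J → ℝ) : (E → ℝ) × (J → ℝ) →ₗ[ℝ] ℝ :=
  (∑ e, N.cost e • LinearMap.proj e) ∘ₗ LinearMap.fst ℝ _ _ +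
    (∑ j, q j • LinearMap.proj j) ∘ₗ LinearMap.snd ℝ _ _

omit [DecidableEq V] in
theorem expenseₗ_apply (N : GenFlowNetwork V E J) (q : J → ℝ) (f : E → ℝ) (s : J → ℝ) :
    N.expenseₗ q (f, s) = N.flowCost f + ∑ j, q j * s j := by
  simp [expenseₗ, flowCost]

theorem ofReal_le_iff_coe_le {r : ℝ} (hr : 0 ≤ r) (c : ℝ≥0∞) :
    ENNReal.ofReal r ≤ c ↔ (r : EReal) ≤ (c : EReal) := by
  rw [← EReal.coe_ennreal_le_coe_ennreal_iff, EReal.coe_ennreal_ofReal, max_eq_left hr]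

/-- A linear objective that is bounded below on the flows with supplies bounded by `X` attains its
minimum. -/
theorem exists_isMin_flow [Finite V] (N : GenFlowNetwork V E J) (X : J → EReal)
    (c : (E → ℝ) × (J → ℝ) →ₗ[ℝ] ℝ) (m : ℝ)
    (hm : ∀ f s, N.IsFeasible s f s → (∀ j, (s j : EReal) ≤ X j) → m ≤ c (f, s))
    (hne : ∃ f s, N.IsFeasible s f s ∧ ∀ j, (s j : EReal) ≤ X j) :
    ∃ f s, N.IsFeasible s f s ∧ (∀ j, (s j : EReal) ≤ X j) ∧
      ∀ g t, N.IsFeasible t g t → (∀ j, (t j : EReal) ≤ X j) → c (f, s) ≤ c (g, t) := by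
  let a : (E ⊕ E) ⊕ (J ⊕ J) ⊕ (V ⊕ V) → ((E → ℝ) × (J → ℝ) →ₗ[ℝ] ℝ) :=
    Sum.elim
      (Sum.elim (fun e => -(LinearMap.proj e ∘ₗ LinearMap.fst ℝ _ _))
        (fun e => LinearMap.proj e ∘ₗ LinearMap.fst ℝ _ _))
      (Sum.elim
        (Sum.elim (fun j => -(LinearMap.proj j ∘ₗ LinearMap.snd ℝ _ _))
          (fun j => LinearMap.proj j ∘ₗ LinearMap.snd ℝ _ _))
        (Sum.elim (fun w => -N.excessₗ w) N.excessₗ))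
  let b : (E ⊕ E) ⊕ (J ⊕ J) ⊕ (V ⊕ V) → EReal :=
    Sum.elim (Sum.elim 0 (fun e => N.cap e))
      (Sum.elim (Sum.elim 0 X) (Sum.elim (fun w => -N.lower w) N.upper))
  have key : ∀ f s, (N.IsFeasible s f s ∧ ∀ j, (s j : EReal) ≤ X j) ↔
      ∀ i, (a i (f, s) : EReal) ≤ b i := by
    intro f s
    simp only [a, b, Sum.forall, Sum.elim_inl, Sum.elim_inr, LinearMap.neg_apply,
      LinearMap.comp_apply, LinearMap.fst_apply, LinearMap.snd_apply, LinearMap.proj_apply,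
      excessₗ_apply, Pi.zero_apply, EReal.coe_neg, EReal.neg_le_neg_iff]
    have h0 : ∀ r : ℝ, -(r : EReal) ≤ 0 ↔ 0 ≤ r := fun r => by
      rw [← EReal.coe_neg, ← EReal.coe_zero, EReal.coe_le_coe_iff, neg_nonpos]
    simp only [h0]
    constructor
    · rintro ⟨h, hX⟩
      exact ⟨⟨h.1, fun e => (ofReal_le_iff_coe_le (h.1 e) _).1 (h.2 e)⟩, ⟨h.3, hX⟩, h.5, h.6⟩
    · rintro ⟨⟨h1, h2⟩, ⟨h3, hX⟩, h5, h6⟩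
      exact ⟨⟨h1, fun e => (ofReal_le_iff_coe_le (h1 e) _).2 (h2 e), h3, fun _ => le_rfl, h5, h6⟩,
        hX⟩
  obtain ⟨⟨f, s⟩, hfs, hmin⟩ := exists_isMin_linearProgram_ereal a b c m
    (fun y hy => have h := (key y.1 y.2).2 hy; hm _ _ h.1 h.2)
    (by obtain ⟨f, s, h⟩ := hne; exact ⟨(f, s), (key f s).1 h⟩)
  have h := (key f s).2 hfs
  exact ⟨f, s, h.1, h.2, fun g t hg ht => hmin (g, t) ((key g t).1 ⟨hg, ht⟩)⟩

omit [DecidableEq V] in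
/-- Tracing flow backwards: at every node, a fraction `α w` of the throughput `T w` is needed in
order to serve the demand `K w` and the fractions needed at the ends of the outgoing arcs. -/
theorem exists_fraction [Finite V] (T K : V → ℝ) (A : V → (V → ℝ) → ℝ)
    (hA : ∀ w, Monotone (A w)) (hA0 : ∀ w, 0 ≤ A w 0) (hK : ∀ w, 0 ≤ K w)
    (hT : ∀ w, K w + A w 1 ≤ T w) :
    ∃ α : V → ℝ, (∀ w, 0 ≤ α w) ∧ (∀ w, α w ≤ 1) ∧ ∀ w, α w * T w = K w + A w α := by
  have hA1 : ∀ (α : V → Set.Icc (0 : ℝ) 1) w, A w (fun v => α v) ≤ A w 1 :=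
    fun α w => hA w fun v => (α v).2.2
  have hA2 : ∀ (α : V → Set.Icc (0 : ℝ) 1) w, 0 ≤ A w (fun v => α v) :=
    fun α w => (hA0 w).trans (hA w fun v => (α v).2.1)
  let F : (V → Set.Icc (0 : ℝ) 1) →o (V → Set.Icc (0 : ℝ) 1) :=
    { toFun := fun α w => ⟨(K w + A w fun v => α v) / T w, by
        have h1 := hA1 α w
        have h2 := hA2 α w
        have h3 := hT w
        have h4 := hK w
        exact ⟨div_nonneg (by linarith) (by linarith),
          div_le_one_of_le₀ (by linarith) (by linarith)⟩⟩
      monotone' := fun α β h w => by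
        have h1 := hA1 α w
        have h2 := hA2 α w
        have h3 := hT w
        have h4 := hK w
        have h5 : A w (fun v => α v) ≤ A w (fun v => β v) := hA w fun v => h v
        exact Subtype.mk_le_mk.2 (div_le_div_of_nonneg_right (by linarith) (by linarith)) }
  have hfix := F.map_lfp
  refine ⟨fun v => F.lfp v, fun w => (F.lfp w).2.1, fun w => (F.lfp w).2.2, fun w => ?_⟩
  have h : (F.lfp w : ℝ) = (K w + A w fun v => F.lfp v) / T w :=
    congrArg Subtype.val (congrFun hfix.symm w)
  rcases eq_or_ne (T w) 0 with h0 | h0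
  · have h1 := hA1 F.lfp w
    have h2 := hA2 F.lfp w
    have h3 := hT w
    have h4 := hK w
    rw [h0, mul_zero]
    linarith
  · exact (congrArg (· * T w) h).trans (div_mul_cancel₀ _ h0)

/-- The part of the flow `d` that is traced by the fractions `α`: positive flow is traced from its
head, negative flow from its tail. -/
def tracedFlow (N : GenFlowNetwork V E J) (α : V → ℝ) (d : E → ℝ) (e : E) : ℝ :=
  α (N.tgt e) * max (d e) 0 - α (N.src e) * max (-d e) 0

/-- The amount that is needed at the far ends of the arcs which carry flow away from `w`. -/
def tracedDemand (N : GenFlowNetwork V E J) (d : E → ℝ) (w : V) (α : V → ℝ) : ℝ :=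
  (∑ e, if N.src e = w then α (N.tgt e) * max (d e) 0 else 0) +
    ∑ e, if N.tgt e = w then α (N.src e) * (N.gain e * max (-d e) 0) else 0

/-- The amount that the arcs carry to `w`. -/
def arrival (N : GenFlowNetwork V E J) (d : E → ℝ) (w : V) : ℝ :=
  (∑ e, if N.src e = w then max (-d e) 0 else 0) +
    ∑ e, if N.tgt e = w then N.gain e * max (d e) 0 else 0

omit [Fintype J] in
theorem netOutflow_tracedFlow (N : GenFlowNetwork V E J) (α : V → ℝ) (d : E → ℝ) (w : V) :
    N.netOutflow (N.tracedFlow α d) w = N.tracedDemand d w α - α w * N.arrival d w := by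
  simp only [netOutflow, tracedDemand, arrival, mul_add, Finset.mul_sum,
    ← Finset.sum_sub_distrib, ← Finset.sum_add_distrib]
  refine Finset.sum_congr rfl fun e _ => ?_
  simp only [tracedFlow]
  split_ifs with h1 h2 h2
  · rw [h1, h2]; ring
  · rw [h1]; ring
  · rw [h2]; ring
  · ring

omit [Fintype J] in
theorem monotone_tracedDemand (N : GenFlowNetwork V E J) (d : E → ℝ) (w : V) :
    Monotone (N.tracedDemand d w) := by
  intro α β h
  refine add_le_add (Finset.sum_le_sum fun e _ => ?_) (Finset.sum_le_sum fun e _ => ?_)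
  · split_ifs
    · exact mul_le_mul_of_nonneg_right (h _) (le_max_right _ _)
    · exact le_rfl
  · split_ifs
    · exact mul_le_mul_of_nonneg_right (h _) (mul_nonneg (N.gain_pos e).le (le_max_right _ _))
    · exact le_rfl

/-- A difference `(d, σ)` of flows contains a sign-consistent part `(z, y)` that has all of the
negative components of `σ` outside of `C`, and none of those in `C`. -/
theorem exists_conformal_part [Finite V] (N : GenFlowNetwork V E J) (d : E → ℝ) (σ : J → ℝ)
    (C : J → Prop) :
    ∃ (z : E → ℝ) (y : J → ℝ),
      (∀ e, ∃ t ∈ Set.Icc (0 : ℝ) 1, z e = t * d e) ∧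
      (∀ j, ∃ t ∈ Set.Icc (0 : ℝ) 1, y j = t * σ j) ∧
      (∀ w, ∃ t ∈ Set.Icc (0 : ℝ) 1, N.excessₗ w (z, y) = t * N.excessₗ w (d, σ)) ∧
      (∀ j, ¬ C j → σ j < 0 → y j = σ j) ∧ ∀ j, C j → 0 ≤ y j := by
  classical
  let K : V → ℝ := fun w => ∑ j, if N.entry j = w then (if C j then 0 else max (-σ j) 0) else 0
  let L : V → ℝ := fun w => ∑ j, if N.entry j = w then max (-σ j) 0 else 0
  let M : V → ℝ := fun w => ∑ j, if N.entry j = w then max (σ j) 0 else 0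
  have hKL : ∀ w, K w ≤ L w := fun w => Finset.sum_le_sum fun j _ => by
    split_ifs
    exacts [le_max_right _ _, le_rfl, le_rfl]
  have hK : ∀ w, 0 ≤ K w := fun w => Finset.sum_nonneg fun j _ => by
    split_ifs
    exacts [le_rfl, le_max_right _ _, le_rfl]
  have hpm : ∀ r : ℝ, max r 0 - max (-r) 0 = r := fun r => by
    rcases le_total 0 r with h | h <;> simp [h]
  have hr : ∀ w, N.excessₗ w (d, σ) =
      N.tracedDemand d w 1 + L w - (N.arrival d w + M w) := fun w => by
    have h1 := N.netOutflow_tracedFlow 1 d w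
    have h2 : N.tracedFlow 1 d = d := funext fun e => by simp [tracedFlow, hpm]
    have h3 : N.supplyAt σ w = M w - L w := by
      simp only [supplyAt, M, L, ← Finset.sum_sub_distrib]
      refine Finset.sum_congr rfl fun j _ => ?_
      split_ifs <;> simp [hpm]
    rw [h2, Pi.one_apply, one_mul] at h1
    rw [excessₗ_apply, h1, h3]
    ring
  obtain ⟨α, hα0, hα1, hα⟩ := exists_fraction
    (fun w => N.arrival d w + M w + max (N.excessₗ w (d, σ)) 0) K (N.tracedDemand d)
    (N.monotone_tracedDemand d) (fun w => by simp [tracedDemand]) hK fun w => by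
      linarith [hKL w, hr w, le_max_left (N.excessₗ w (d, σ)) 0]
  let y : J → ℝ := fun j =>
    α (N.entry j) * max (σ j) 0 - if C j then 0 else max (-σ j) 0
  have hy : ∀ w, N.supplyAt y w = α w * M w - K w := fun w => by
    simp only [supplyAt, M, K, Finset.mul_sum, ← Finset.sum_sub_distrib]
    refine Finset.sum_congr rfl fun j _ => ?_
    by_cases h : N.entry j = w
    · simp only [y, h, if_true]
    · simp [if_neg h]
  refine ⟨N.tracedFlow α d, y, fun e => ?_, fun j => ?_, fun w => ?_, fun j hC hj => ?_,
    fun j hC => ?_⟩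
  · rcases le_total 0 (d e) with h | h
    · exact ⟨α (N.tgt e), ⟨hα0 _, hα1 _⟩, by simp [tracedFlow, h]⟩
    · exact ⟨α (N.src e), ⟨hα0 _, hα1 _⟩, by simp [tracedFlow, h]⟩
  · rcases le_total 0 (σ j) with h | h
    · exact ⟨α (N.entry j), ⟨hα0 _, hα1 _⟩, by simp [y, h]⟩
    · by_cases hC : C j
      · exact ⟨0, by simp, by simp [y, h, hC]⟩
      · exact ⟨1, by simp, by simp [y, h, hC]⟩
  · have h : N.excessₗ w (N.tracedFlow α d, y) = α w * max (N.excessₗ w (d, σ)) 0 := by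
      rw [excessₗ_apply, netOutflow_tracedFlow, hy]
      linarith [hα w]
    rw [h]
    rcases le_total 0 (N.excessₗ w (d, σ)) with h | h
    · exact ⟨α w, ⟨hα0 _, hα1 _⟩, by rw [max_eq_left h]⟩
    · exact ⟨0, by simp, by rw [max_eq_right h]; simp⟩
  · simp [y, hC, hj.le]
  · simp only [y, if_pos hC, sub_zero]
    exact mul_nonneg (hα0 _) (le_max_right _ _)

theorem IsFeasible.mono {N : GenFlowNetwork V E J} {x x' : J → ℝ} {f : E → ℝ} {s : J → ℝ}
    (h : N.IsFeasible x f s) (hs : s ≤ x') : N.IsFeasible x' f s :=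
  ⟨h.1, h.2, h.3, hs, h.5, h.6⟩

theorem IsFeasible.coe_le_valuation {N : GenFlowNetwork V E J} {x : J → ℝ} {f : E → ℝ} {s : J → ℝ}
    (h : N.IsFeasible x f s) : ((-N.flowCost f : ℝ) : EReal) ≤ N.valuation x :=
  le_sSup ⟨f, s, h, rfl⟩

theorem valuation_le {N : GenFlowNetwork V E J} {x : J → ℝ} {b : EReal}
    (h : ∀ f s, N.IsFeasible x f s → ((-N.flowCost f : ℝ) : EReal) ≤ b) : N.valuation x ≤ b :=
  sSup_le <| by
    rintro _ ⟨f, s, hfs, rfl⟩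
    exact h f s hfs

/-- Two feasible flows can be exchanged along a sign-consistent part of their difference. -/
theorem IsFeasible.exchange {N : GenFlowNetwork V E J} {f g z : E → ℝ} {s t y : J → ℝ}
    (hf : N.IsFeasible s f s) (hg : N.IsFeasible t g t)
    (hz : ∀ e, ∃ τ ∈ Set.Icc (0 : ℝ) 1, z e = τ * (g - f) e)
    (hy : ∀ j, ∃ τ ∈ Set.Icc (0 : ℝ) 1, y j = τ * (t - s) j)
    (hw : ∀ w, ∃ τ ∈ Set.Icc (0 : ℝ) 1, N.excessₗ w (z, y) = τ * N.excessₗ w (g - f, t - s)) :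
    N.IsFeasible (s + y) (f + z) (s + y) := by
  have hmix : ∀ {r r' τ : ℝ} (_ : τ ∈ Set.Icc (0 : ℝ) 1),
      min r r' ≤ r + τ * (r' - r) ∧ r + τ * (r' - r) ≤ max r r' := by
    intro r r' τ hτ
    have := hτ.1
    have := hτ.2
    rcases le_total r r' with h | h
    · rw [min_eq_left h, max_eq_right h]
      constructor <;> nlinarith
    · rw [min_eq_right h, max_eq_left h]
      constructor <;> nlinarith
  have hex : ∀ w, ∃ τ ∈ Set.Icc (0 : ℝ) 1, N.netOutflow (f + z) w - N.supplyAt (s + y) w =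
      (N.netOutflow f w - N.supplyAt s w) + τ * ((N.netOutflow g w - N.supplyAt t w) -
        (N.netOutflow f w - N.supplyAt s w)) := fun w => by
    obtain ⟨τ, hτ, h⟩ := hw w
    refine ⟨τ, hτ, ?_⟩
    rw [← Prod.mk_sub_mk, map_sub] at h
    have h2 := map_add (N.excessₗ w) (f, s) (z, y)
    rw [h, Prod.mk_add_mk] at h2
    simpa only [excessₗ_apply] using h2
  refine ⟨fun e => ?_, fun e => ?_, fun j => ?_, fun j => le_rfl, fun w => ?_, fun w => ?_⟩
  · obtain ⟨τ, hτ, h⟩ := hz e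
    rw [Pi.add_apply, h]
    exact (le_min (hf.1 e) (hg.1 e)).trans (hmix hτ).1
  · obtain ⟨τ, hτ, h⟩ := hz e
    rw [Pi.add_apply, h]
    refine (ENNReal.ofReal_le_ofReal (hmix hτ).2).trans ?_
    rw [ENNReal.ofReal_max]
    exact max_le (hf.2 e) (hg.2 e)
  · obtain ⟨τ, hτ, h⟩ := hy j
    rw [Pi.add_apply, h]
    exact (le_min (hf.3 j) (hg.3 j)).trans (hmix hτ).1
  · obtain ⟨τ, hτ, h⟩ := hex w
    rw [h]
    refine le_trans ?_ (EReal.coe_le_coe_iff.2 (hmix hτ).1)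
    rw [EReal.coe_strictMono.monotone.map_min]
    exact le_min (hf.5 w) (hg.5 w)
  · obtain ⟨τ, hτ, h⟩ := hex w
    rw [h]
    refine (EReal.coe_le_coe_iff.2 (hmix hτ).2).trans ?_
    rw [EReal.coe_strictMono.monotone.map_max]
    exact max_le (hf.6 w) (hg.6 w)

/-- If `(f, s)` minimizes the expense at prices `q` and `(g, t)` at prices `q' ≥ q`, then some
minimizer at `q'` uses at least as much as `s` of each item whose price did not change. -/
theorem exists_isMin_ge [Finite V] (N : GenFlowNetwork V E J) {q q' : J → ℝ} (hq : q ≤ q')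
    {f g : E → ℝ} {s t : J → ℝ} (hf : N.IsFeasible s f s) (hg : N.IsFeasible t g t)
    (hfmin : ∀ f' s', N.IsFeasible s' f' s' → N.expenseₗ q (f, s) ≤ N.expenseₗ q (f', s'))
    (hgmin : ∀ f' s', N.IsFeasible s' f' s' → N.expenseₗ q' (g, t) ≤ N.expenseₗ q' (f', s')) :
    ∃ g' t', N.IsFeasible t' g' t' ∧
      (∀ f' s', N.IsFeasible s' f' s' → N.expenseₗ q' (g', t') ≤ N.expenseₗ q' (f', s')) ∧
      ∀ j, q j = q' j → s j ≤ t' j := by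
  obtain ⟨z, y, hz, hy, hw, hneg, hpos⟩ :=
    N.exists_conformal_part (g - f) (t - s) fun j => q j ≠ q' j
  have h1 := hf.exchange hg hz hy hw
  have h2 : N.IsFeasible (t + -y) (g + -z) (t + -y) := by
    refine hg.exchange hf (fun e => ?_) (fun j => ?_) fun w => ?_
    · obtain ⟨τ, hτ, h⟩ := hz e
      exact ⟨τ, hτ, by simp only [Pi.neg_apply, h, Pi.sub_apply]; ring⟩
    · obtain ⟨τ, hτ, h⟩ := hy j
      exact ⟨τ, hτ, by simp only [Pi.neg_apply, h, Pi.sub_apply]; ring⟩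
    · obtain ⟨τ, hτ, h⟩ := hw w
      refine ⟨τ, hτ, ?_⟩
      rw [← Prod.neg_mk, map_neg, h, ← neg_sub g f, ← neg_sub t s, ← Prod.neg_mk, map_neg, mul_neg]
  refine ⟨g + -z, t + -y, h2, fun f' s' h' => le_trans ?_ (hgmin f' s' h'), fun j hj => ?_⟩
  · have h3 := hfmin _ _ h1
    have h4 : N.expenseₗ q (z, y) ≤ N.expenseₗ q' (z, y) := by
      rw [expenseₗ_apply, expenseₗ_apply]
      refine add_le_add_right (Finset.sum_le_sum fun j _ => ?_) _
      rcases eq_or_ne (q j) (q' j) with h | h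
      · rw [h]
      · exact mul_le_mul_of_nonneg_right (hq j) (hpos j h)
    rw [← Prod.mk_add_mk, map_add] at h3
    rw [← Prod.mk_add_mk, ← Prod.neg_mk, map_add, map_neg]
    linarith
  · rcases lt_or_ge ((t - s) j) 0 with h | h
    · have := hneg j (not_not.2 hj) h
      simp only [Pi.sub_apply] at this
      simp only [Pi.add_apply, Pi.neg_apply, this]
      linarith
    · obtain ⟨τ, hτ, hyj⟩ := hy j
      have := mul_le_of_le_one_left h hτ.2
      simp only [Pi.sub_apply] at this hyj
      simp only [Pi.add_apply, Pi.neg_apply, hyj]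
      linarith

/-- A bundle demanded at prices `q` contains the supplies of a flow of minimal expense, and the
items which this flow does not use have price zero. -/
theorem exists_isMin_of_mem_demandSet [Finite V] (N : GenFlowNetwork V E J) {q x : J → ℝ}
    (hx : x ∈ demandSet N.valuation q) :
    (∀ j, 0 ≤ q j) ∧ ∃ f s, N.IsFeasible s f s ∧ (∀ j, s j ≤ x j) ∧
      (∀ j, q j * x j = q j * s j) ∧
      ∀ g t, N.IsFeasible t g t → N.expenseₗ q (f, s) ≤ N.expenseₗ q (g, t) := by
  classical
  obtain ⟨hx0, hbot, htop, hmax⟩ := hx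
  obtain ⟨m, hm⟩ : ∃ m : ℝ, N.valuation x = m := ⟨_, (EReal.coe_toReal htop hbot).symm⟩
  have hmax' : ∀ y f s, 0 ≤ y → N.IsFeasible y f s →
      -N.flowCost f - ∑ j, q j * y j ≤ m - ∑ j, q j * x j := fun y f s hy h => by
    have := (EReal.sub_le_sub h.coe_le_valuation le_rfl).trans (hmax y hy)
    rw [hm] at this
    exact_mod_cast this
  have hcost : ∀ f s, N.expenseₗ 0 (f, s) = N.flowCost f := fun f s => by simp [expenseₗ_apply]
  obtain ⟨f, s, hfs, hsx, hmin⟩ := N.exists_isMin_flow (fun j => x j) (N.expenseₗ 0) (-m)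
    (fun f s h hs => by
      have h1 := (h.mono fun j => EReal.coe_le_coe_iff.1 (hs j)).coe_le_valuation
      rw [hm, EReal.coe_le_coe_iff] at h1
      rw [hcost]
      linarith)
    (by
      by_contra hne
      refine hbot (le_bot_iff.1 (valuation_le fun f s h => ?_))
      exact (hne ⟨f, s, h.mono le_rfl, fun j => EReal.coe_le_coe_iff.2 (h.4 j)⟩).elim)
  simp only [EReal.coe_le_coe_iff, hcost] at hsx hmin
  have hmf : m ≤ -N.flowCost f := by
    rw [← EReal.coe_le_coe_iff, ← hm]
    refine valuation_le fun g t h => EReal.coe_le_coe_iff.2 ?_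
    linarith [hmin g t (h.mono le_rfl) h.4]
  have hupd : ∀ j r, s j ≤ r → 0 ≤ q j * (r - x j) := fun j r hr => by
    have h1 := hmax' (Function.update x j r) f s
      (fun i => by
        by_cases h : i = j
        · subst h; simpa using (hfs.3 i).trans hr
        · simpa [h] using hx0 i)
      (hfs.mono fun i => by
        by_cases h : i = j
        · subst h; simpa using hr
        · simpa [h] using hsx i)
    have h2 : ∑ i, q i * Function.update x j r i - ∑ i, q i * x i = q j * (r - x j) := by
      rw [← Finset.sum_sub_distrib, Finset.sum_eq_single j]
      · simp [mul_sub]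
      · intro i _ h
        simp [h]
      · simp
    linarith
  have hq0 : ∀ j, 0 ≤ q j := fun j => by simpa using hupd j (x j + 1) (by linarith [hsx j])
  have hqs : ∀ j, q j * x j = q j * s j := fun j => by
    have h1 := hupd j (s j) le_rfl
    have h2 := mul_le_mul_of_nonneg_left (hsx j) (hq0 j)
    linarith
  refine ⟨hq0, f, s, hfs, hsx, hqs, fun g t h => ?_⟩
  have h1 := hmax' t g t h.3 h
  rw [Finset.sum_congr rfl fun j _ => hqs j] at h1
  rw [expenseₗ_apply, expenseₗ_apply]
  linarith

/-- Flows of minimal expense yield demanded bundles; unused items of price zero may be added. -/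
theorem mem_demandSet_of_isMin {N : GenFlowNetwork V E J} {q x s : J → ℝ} {f : E → ℝ}
    (hq : ∀ j, 0 ≤ q j) (hf : N.IsFeasible s f s) (hsx : s ≤ x)
    (hqs : ∀ j, q j * x j = q j * s j)
    (hmin : ∀ g t, N.IsFeasible t g t → N.expenseₗ q (f, s) ≤ N.expenseₗ q (g, t)) :
    x ∈ demandSet N.valuation q := by
  have hle : ∀ y, N.valuation y ≤
      ((-N.flowCost f - ∑ j, q j * x j + ∑ j, q j * y j : ℝ) : EReal) := fun y =>
    valuation_le fun g t h => EReal.coe_le_coe_iff.2 <| by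
      have h1 := hmin g t (h.mono le_rfl)
      have h2 : ∑ j, q j * t j ≤ ∑ j, q j * y j :=
        Finset.sum_le_sum fun j _ => mul_le_mul_of_nonneg_left (h.4 j) (hq j)
      rw [expenseₗ_apply, expenseₗ_apply] at h1
      rw [Finset.sum_congr rfl fun j _ => hqs j]
      linarith
  have hx : N.valuation x = ((-N.flowCost f : ℝ) : EReal) := by
    refine le_antisymm ?_ (hf.mono hsx).coe_le_valuation
    simpa only [sub_add_cancel] using hle x
  refine ⟨fun j => (hf.3 j).trans (hsx j), ?_, ?_, fun y _ => ?_⟩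
  · rw [hx]; exact EReal.coe_ne_bot _
  · rw [hx]; exact EReal.coe_ne_top _
  · refine (EReal.sub_le_sub (hle y) le_rfl).trans (le_of_eq ?_)
    rw [hx, ← EReal.coe_sub, ← EReal.coe_sub, add_sub_cancel_right]

end GenFlowNetwork

theorem mainTheorem4 {V E J : Type*} [Fintype V] [Fintype E] [Fintype J] [DecidableEq V]
    (N : GenFlowNetwork V E J) : IsLinearSubstitute N.valuation := by
  classical
  intro q q' hqq x hx
  obtain ⟨hq0, f, s, hfs, hsx, hqs, hfmin⟩ := N.exists_isMin_of_mem_demandSet hx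
  have hq0' : ∀ j, 0 ≤ q' j := fun j => (hq0 j).trans (hqq j)
  obtain ⟨g, t, hgt, -, hgmin⟩ := N.exists_isMin_flow (fun _ => ⊤) (N.expenseₗ q')
    (N.expenseₗ q (f, s))
    (fun g t h _ => (hfmin g t h).trans <| by
      rw [GenFlowNetwork.expenseₗ_apply, GenFlowNetwork.expenseₗ_apply]
      exact add_le_add_right
        (Finset.sum_le_sum fun j _ => mul_le_mul_of_nonneg_right (hqq j) (h.3 j)) _)
    ⟨f, s, hfs, fun _ => le_top⟩
  obtain ⟨g', t', hgt', hmin, hge⟩ := N.exists_isMin_ge hqq hfs hgt hfmin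
    fun f' s' h => hgmin f' s' h fun _ => le_top
  refine ⟨fun j => if q j = q' j then max (x j) (t' j) else t' j,
    GenFlowNetwork.mem_demandSet_of_isMin hq0' hgt' (fun j => ?_) (fun j => ?_) hmin,
    fun j hj => ?_⟩
  · split_ifs
    exacts [le_max_right _ _, le_rfl]
  · split_ifs with h
    · rcases le_total (x j) (t' j) with h1 | h1
      · rw [max_eq_right h1]
      · rw [max_eq_left h1]
        have h2 := hqs j
        have h3 := mul_le_mul_of_nonneg_left (hge j h) (hq0' j)
        have h4 := mul_le_mul_of_nonneg_left h1 (hq0' j)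
        rw [h] at h2
        linarith
    · rfl
  · simp only [if_pos hj, le_max_left]
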